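/- Let $n\ge 1$. For a number field $K$ with $[K:\mathbb{Q}]=n$, a nonzero prime ideal $\mathfrak{p}$ of $\mathcal{O}_K$ lying above the prime number $p$, and an integer $e\ge 1$, put $q=|\mathcal{O}_K/\mathfrak{p}|$, $R_e=\mathcal{O}_K/\mathfrak{p}^e$, $G_e=\mathrm{SL}_2(R_e)$ and $U_e=\left\{\begin{pmatrix}1&x\\0&1\end{pmatrix}: x\in R_e\right\}$. For a subgroup $H\subset G_e$ put $$\chi_e(H)=\frac{|H\backslash G_e/U_e|}{[G_e:H]}.$$ For $e>1$, $H$ is said to have exact level $e$ if $H$ is not the full preimage, under the reduction map $G_e\to G_{e-1}$, of its image in $G_{e-1}$; for $e=1$, $H$ is said to have exact level $1$ if $H\ne G_1$. (i) There are constants $B,\alpha>0$ depending only on $n$ such that, for every number field $K$ of degree $n$, every nonzero prime ideal $\mathfrak{p}$ of $\mathcal{O}_K$, every $e\ge 1$ and every subgroup $H\subset G_e$ of exact level $e$, $$\chi_e(H)\le q^{B-\alpha e}.$$ (ii) Explicitly, for all such $K$, $\mathfrak{p}$, $e$ and $H$: if $p\ge 3$, then $$\chi_e(H)\le q^{B_1-\alpha_1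 e},\qquad \alpha_1=\frac{1}{2n(6+4n)},\quad B_1=7n+4;$$ if $p=2$, then $$\chi_e(H)\le q^{B_2-\alpha_2 e},\qquad \alpha_2=\frac{1}{2n(18+34n)},\quad B_2=\frac{13}{2}n^2+\frac{27}{2}n+\frac{17}{2}.$$ -/

import Mathlib

open scoped NumberField MatrixGroups

universe u

namespace LocalCusp

/-- The upper unipotent subgroup of `SL₂(A)`: all matrices `(1 x; 0 1)` with `x ∈ A`. -/
def upperUnipotent (A : Type*) [CommRing A] : Subgroup SL(2, A) where
  carrier := {g | ∃ x : A, (g : Matrix (Fin 2) (Fin 2) A) = !![1, x; 0, 1]}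
  one_mem' := ⟨0, by
    rw [Matrix.SpecialLinearGroup.coe_one, Matrix.one_fin_two]⟩
  mul_mem' := by
    rintro a b ⟨x, hx⟩ ⟨y, hy⟩
    refine ⟨x + y, ?_⟩
    rw [Matrix.SpecialLinearGroup.coe_mul, hx, hy, Matrix.mul_fin_two]
    simp [add_comm]
  inv_mem' := by
    rintro a ⟨x, hx⟩
    refine ⟨-x, ?_⟩
    rw [Matrix.SpecialLinearGroup.coe_inv, hx, Matrix.adjugate_fin_two_of]
    simp

/-- The ratio `|H \ X| / [SL₂(A) : H]`, where `X = SL₂(A) / U` is the space of left cosets of the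
upper unipotent subgroup `U`, on which `H` acts by left multiplication. It is only used for
finite rings `A`. -/
noncomputable def chi {A : Type*} [CommRing A] (H : Subgroup SL(2, A)) : ℝ :=
  (Nat.card (MulAction.orbitRel.Quotient H (SL(2, A) ⧸ upperUnipotent A)) : ℝ) / (H.index : ℝ)

/-- The reduction map `SL₂(R / I ^ k) → SL₂(R / I ^ j)` for `j ≤ k`. -/
def reduction {R : Type*} [CommRing R] (I : Ideal R) {j k : ℕ} (h : j ≤ k) :
    SL(2, R ⧸ I ^ k) →* SL(2, R ⧸ I ^ j) :=
  Matrix.SpecialLinearGroup.map (Ideal.Quotient.factorPow I h)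

/-- A subgroup `H` of `SL₂(R / I ^ e)`, `e ≥ 1`, has exact level `e` if it is not the full preimage
of its reduction modulo `I ^ (e - 1)` (when `e > 1`), and if it is a proper subgroup
(when `e = 1`). -/
def HasExactLevel {R : Type*} [CommRing R] (I : Ideal R) (e : ℕ)
    (H : Subgroup SL(2, R ⧸ I ^ e)) : Prop :=
  (1 < e → H ≠ (H.map (reduction I (Nat.sub_le e 1))).comap (reduction I (Nat.sub_le e 1))) ∧
  (e = 1 → H ≠ ⊤)

end LocalCusp

/-!
Let `A = 𝓞 K ⧸ 𝔭 ^ e` and let `π` generate its maximal ideal. By Burnside's lemma, `chi H` is the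
average over `g ∈ SL₂(A)` of `|V_g| / |A|`, where `V_g`, `unipotentParameters H g`, is the additive
subgroup of all `x ∈ A` with `g (1 x; 0 1) g⁻¹ ∈ H` (`chi_mul_card`). So if `chi H > q ^ (-m)`, then
for more than `|SL₂(A)| / (2 q ^ m)` elements `g` the index of `V_g` is at most `2 q ^ m`
(`card_lt_of_lt_chi`). Two things follow.

* The index of `V_g` is a power of `p`, and it kills `A / V_g`. Since ramification index times
  residue degree is at most `n = [K : ℚ]`, the subgroup `V_g` contains `π ^ a A` as soon as
  `a ≥ n (m + 1)` (`pow_mul_mem_of_index_le`, `mul_le_finrank_of_mem_pow`).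
* The condition that the first columns of `g` and `g'` agree on the projective line modulo
  `π ^ (m + 2)` cuts out a coset of a subgroup of index at least `q ^ (m + 2)`. Two such cosets do
  not exhaust the good `g`, so there are three good elements whose first columns `vᵢ` have pairwise
  determinants dividing `π ^ (m + 1)` (`exists_three_separated`, `dvd_pow_of_not_pow_succ_dvd`).

The unipotents fixing `vᵢ = (a, c)` are `1 + x Nᵢ` with `Nᵢ = (-ac a²; -c² ac)`, and by Lagrange
interpolation `N₁, N₂, N₃` span all traceless matrices up to the product of the three determinants,
hence up to `π ^ (3 (m + 1))` (`exists_nilpotent_combination`). Put `a = e - 1 - 3 (m + 1)`. When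
`2 a ≥ e`, products of elements `1 + π ^ a x Nᵢ` are computed by adding the `π ^ a x Nᵢ`, so `H`
contains the whole kernel of reduction modulo `𝔭 ^ (e - 1)` (`mem_of_unipotentParameters`), against
its exact level being `e`. All constraints hold when `(n + 6) (m + 3) ≤ e`. This gives
`chi H ≤ q ^ (B - α e)` whenever `B ≥ 4` and `α (n + 6) ≤ 1` (`chi_le_rpow`), for even and odd `p`
alike.
-/

namespace LocalCusp

/-! ### Conjugates of the upper unipotent subgroup -/

section UnipotentConjugates

variable {A : Type*} [CommRing A]

/-- The unipotent matrix `(1 x; 0 1)`. -/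
def upper (x : A) : SL(2, A) := ⟨!![1, x; 0, 1], by simp⟩

/-- The unipotent matrix `(1 0; x 1)`. -/
def lower (x : A) : SL(2, A) := ⟨!![1, 0; x, 1], by simp⟩

theorem upper_zero : upper (0 : A) = 1 := by
  ext i j; fin_cases i <;> fin_cases j <;> simp [upper]

theorem upper_add (x y : A) : upper (x + y) = upper x * upper y := by
  ext i j; rw [Matrix.SpecialLinearGroup.coe_mul]
  fin_cases i <;> fin_cases j <;> simp [upper, Matrix.mul_apply, Fin.sum_univ_two, add_comm]

theorem upper_neg (x : A) : upper (-x) = (upper x)⁻¹ := by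
  rw [eq_inv_iff_mul_eq_one, ← upper_add, neg_add_cancel, upper_zero]

theorem upper_injective : Function.Injective (upper : A → SL(2, A)) := fun x y h => by
  simpa [upper] using congrArg (fun g : SL(2, A) => g 0 1) h

theorem mem_upperUnipotent {g : SL(2, A)} : g ∈ upperUnipotent A ↔ ∃ x, upper x = g :=
  exists_congr fun _ => ⟨fun h => Subtype.ext h.symm, fun h => congrArg Subtype.val h.symm⟩

/-- The parametrization of the upper unipotent subgroup by its upper right entry. -/
noncomputable def upperUnipotentEquiv : A ≃ upperUnipotent A :=
  Equiv.ofBijective (fun x => ⟨upper x, mem_upperUnipotent.2 ⟨x, rfl⟩⟩)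
    ⟨fun _ _ h => upper_injective (congrArg Subtype.val h), fun ⟨_, hg⟩ =>
      (mem_upperUnipotent.1 hg).imp fun _ h => Subtype.ext h⟩

/-- The matrix `v · (-c, a)` for the column `v = (a, c)ᵀ`; the unipotents of `SL₂(A)` fixing a
primitive vector `v` are the `1 + x • nilpotentOf a c`. -/
def nilpotentOf (a c : A) : Matrix (Fin 2) (Fin 2) A := !![-(a * c), a ^ 2; -c ^ 2, a * c]

theorem coe_conj_upper (g : SL(2, A)) (x : A) :
    ((g * upper x * g⁻¹ : SL(2, A)) : Matrix (Fin 2) (Fin 2) A) =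
      1 + x • nilpotentOf (g 0 0) (g 1 0) := by
  have hdet := g.det_coe
  rw [Matrix.det_fin_two] at hdet
  rw [Matrix.SpecialLinearGroup.coe_mul, Matrix.SpecialLinearGroup.coe_mul,
    Matrix.SpecialLinearGroup.coe_inv, Matrix.adjugate_fin_two]
  ext i j
  fin_cases i <;> fin_cases j <;>
    simp [upper, nilpotentOf, Matrix.mul_apply, Fin.sum_univ_two] <;>
    grind

theorem inv_mul_apply_one_zero (g h : SL(2, A)) :
    (g⁻¹ * h) 1 0 = g 0 0 * h 1 0 - g 1 0 * h 0 0 := by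
  rw [Matrix.SpecialLinearGroup.coe_mul, Matrix.SpecialLinearGroup.coe_inv,
    Matrix.adjugate_fin_two]
  simp [Matrix.mul_apply, Fin.sum_univ_two]
  ring

/-- The matrices `nilpotentOf` are the squares of linear forms in disguise, so this is Lagrange
interpolation for binary quadratic forms at three points of the projective line. -/
theorem exists_nilpotent_combination (a₁ c₁ a₂ c₂ a₃ c₃ x y z : A) :
    ∃ y₁ y₂ y₃ : A, y₁ • nilpotentOf a₁ c₁ + y₂ • nilpotentOf a₂ c₂ + y₃ • nilpotentOf a₃ c₃ =
      ((a₁ * c₂ - c₁ * a₂) * (a₁ * c₃ - c₁ * a₃) * (a₂ * c₃ - c₂ * a₃)) • !![x, y; z, -x] := by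
  -- `y₁` is `-det(v₂, v₃)` times the bilinear form of `!![x, y; z, -x]` at `(v₂, v₃)`, and so on
  refine ⟨-(a₂ * c₃ - c₂ * a₃) * (a₂ * (z * a₃ - x * c₃) - c₂ * (x * a₃ + y * c₃)),
    (a₁ * c₃ - c₁ * a₃) * (a₁ * (z * a₃ - x * c₃) - c₁ * (x * a₃ + y * c₃)),
    -(a₁ * c₂ - c₁ * a₂) * (a₁ * (z * a₂ - x * c₂) - c₁ * (x * a₂ + y * c₂)), ?_⟩
  ext i j
  fin_cases i <;> fin_cases j <;> simp [nilpotentOf] <;> ring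

theorem one_add_smul_mul_one_add_smul {s : A} (hs : s * s = 0) (P Q : Matrix (Fin 2) (Fin 2) A) :
    (1 + s • P) * (1 + s • Q) = 1 + s • (P + Q) := by
  simp only [mul_add, add_mul, one_mul, mul_one, Matrix.smul_mul, Matrix.mul_smul, smul_smul, hs,
    zero_smul, smul_add, add_zero]
  abel

/-- The set of `x : A` for which the conjugate by `g` of the unipotent `(1 x; 0 1)` lies in `H`. -/
def unipotentParameters (H : Subgroup SL(2, A)) (g : SL(2, A)) : AddSubgroup A where
  carrier := {x | g * upper x * g⁻¹ ∈ H}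
  zero_mem' := by simp [upper_zero, H.one_mem]
  add_mem' {x y} hx hy := by
    have h := H.mul_mem hx hy
    simpa only [Set.mem_ofPred_eq, upper_add, mul_assoc, inv_mul_cancel_left] using h
  neg_mem' {x} hx := by
    have h := H.inv_mem hx
    simpa only [Set.mem_ofPred_eq, upper_neg, mul_inv_rev, inv_inv, mul_assoc] using h

/-- If `H` contains the unipotents of depth `s` (where `s ^ 2 = 0`) fixing three vectors, then it
contains every element congruent to `1` modulo `s` times the three pairwise determinants. -/
theorem mem_of_unipotentParameters {H : Subgroup SL(2, A)} {g₁ g₂ g₃ k : SL(2, A)}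
    {s x y z : A} (hs : s * s = 0)
    (h₁ : ∀ u, s * u ∈ unipotentParameters H g₁) (h₂ : ∀ u, s * u ∈ unipotentParameters H g₂)
    (h₃ : ∀ u, s * u ∈ unipotentParameters H g₃)
    (hk : (k : Matrix (Fin 2) (Fin 2) A) =
      1 + (s * ((g₁⁻¹ * g₂) 1 0 * (g₁⁻¹ * g₃) 1 0 * (g₂⁻¹ * g₃) 1 0)) • !![x, y; z, -x]) :
    k ∈ H := by
  obtain ⟨y₁, y₂, y₃, hy⟩ := exists_nilpotent_combination (g₁ 0 0) (g₁ 1 0) (g₂ 0 0) (g₂ 1 0)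
    (g₃ 0 0) (g₃ 1 0) x y z
  have : k = (g₁ * upper (s * y₁) * g₁⁻¹) * (g₂ * upper (s * y₂) * g₂⁻¹) *
      (g₃ * upper (s * y₃) * g₃⁻¹) := by
    apply Subtype.ext
    rw [Matrix.SpecialLinearGroup.coe_mul, Matrix.SpecialLinearGroup.coe_mul, coe_conj_upper,
      coe_conj_upper, coe_conj_upper, mul_smul, mul_smul, mul_smul,
      one_add_smul_mul_one_add_smul hs, one_add_smul_mul_one_add_smul hs, hy, smul_smul, hk,
      inv_mul_apply_one_zero, inv_mul_apply_one_zero, inv_mul_apply_one_zero]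
  rw [this]
  exact H.mul_mem (H.mul_mem (h₁ y₁) (h₂ y₂)) (h₃ y₃)

end UnipotentConjugates

/-! ### Counting in `SL₂` of a finite ring -/

section Counting

variable {A : Type*} [CommRing A] [Finite A]

/-- Burnside's lemma for the action of `H` on `SL₂(A) ⧸ U`, averaged over `SL₂(A)`. -/
theorem chi_mul_card (H : Subgroup SL(2, A)) :
    chi H * (Nat.card SL(2, A) * Nat.card A : ℕ) =
      ∑ᶠ g : SL(2, A), (Nat.card (unipotentParameters H g) : ℝ) := by
  classical
  have := Fintype.ofFinite SL(2, A)
  have := Fintype.ofFinite H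
  -- the pairs `(h, g)` with `h` fixing the coset `gU`, fibred over `h` and over `g`
  let e₁ : (Σ h : H, {g : SL(2, A) // (g : SL(2, A) ⧸ upperUnipotent A) ∈
      MulAction.fixedBy (SL(2, A) ⧸ upperUnipotent A) h}) ≃
      (Σ g : SL(2, A), unipotentParameters H g) := by
    refine Equiv.symm <| Equiv.ofBijective
      (fun p => ⟨⟨p.1 * upper (p.2 : A) * p.1⁻¹, p.2.2⟩, p.1, ?_⟩) ⟨?_, ?_⟩
    · rw [MulAction.mem_fixedBy]
      refine QuotientGroup.eq.2 (mem_upperUnipotent.2 ⟨-(p.2 : A), ?_⟩)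
      simp [upper_neg, mul_assoc]
    · rintro ⟨g, x, hx⟩ ⟨g', x', hx'⟩ h
      have hg : g = g' := by simpa using congrArg (fun p => (p.2 : SL(2, A))) h
      subst hg
      have h1 : g * upper x * g⁻¹ = g * upper x' * g⁻¹ := congrArg (fun p => (p.1 : SL(2, A))) h
      have h2 : x = x' := upper_injective (by simpa using h1)
      subst h2; rfl
    · rintro ⟨⟨h, hH⟩, g, hg⟩
      have hg' := hg
      rw [MulAction.mem_fixedBy] at hg'
      obtain ⟨x, hx⟩ := mem_upperUnipotent.1 (QuotientGroup.eq.1 hg'.symm)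
      have hh : g * upper x * g⁻¹ = h := by
        rw [hx]; simp
      subst hh
      exact ⟨⟨g, x, hH⟩, rfl⟩
  have hcount := Nat.card_congr e₁
  rw [Nat.card_sigma, Nat.card_sigma] at hcount
  have hfix : ∀ h : H, Nat.card {g : SL(2, A) // (g : SL(2, A) ⧸ upperUnipotent A) ∈
      MulAction.fixedBy (SL(2, A) ⧸ upperUnipotent A) h} =
      Nat.card A * Nat.card (MulAction.fixedBy (SL(2, A) ⧸ upperUnipotent A) h) := fun h => by
    rw [Nat.card_congr (upperUnipotentEquiv (A := A)), ← Nat.card_prod]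
    exact Nat.card_congr ((Equiv.subtypeEquivRight fun _ => Iff.rfl).trans
      (QuotientGroup.preimageMkEquivSubgroupProdSet (upperUnipotent A)
        (MulAction.fixedBy (SL(2, A) ⧸ upperUnipotent A) h)))
  simp_rw [hfix] at hcount
  rw [← Finset.mul_sum, ← Nat.card_sigma,
    Nat.card_congr (MulAction.sigmaFixedByEquivOrbitsProdGroup H (SL(2, A) ⧸ upperUnipotent A)),
    Nat.card_prod] at hcount
  rw [finsum_eq_sum_of_fintype, ← Nat.cast_sum, ← hcount, ← H.card_mul_index, chi]
  have : (H.index : ℝ) ≠ 0 := by exact_mod_cast H.index_ne_zero_of_finite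
  push_cast
  field_simp

theorem chi_le_one (H : Subgroup SL(2, A)) : chi H ≤ 1 := by
  have := Fintype.ofFinite SL(2, A)
  have hpos : (0 : ℝ) < (Nat.card SL(2, A) * Nat.card A : ℕ) := by
    exact_mod_cast Nat.mul_pos Nat.card_pos Nat.card_pos
  refine le_of_mul_le_mul_right ?_ hpos
  rw [chi_mul_card, finsum_eq_sum_of_fintype, one_mul]
  refine (Finset.sum_le_card_nsmul _ _ (Nat.card A : ℝ) fun g _ => ?_).trans ?_
  · exact_mod_cast Nat.card_le_card_of_injective _ Subtype.val_injective
  · simp [Nat.card_eq_fintype_card]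

/-- If `chi H > 1 / N`, then a proportion of more than `1 / (2 N)` of all `g` are such that the
unipotent parameters at `g` have index at most `2 N`. -/
theorem card_lt_of_lt_chi {H : Subgroup SL(2, A)} {N : ℕ} (hN : 0 < N)
    (h : (1 : ℝ) / N < chi H) :
    Nat.card SL(2, A) <
      2 * N * Nat.card {g : SL(2, A) // (unipotentParameters H g).index ≤ 2 * N} := by
  classical
  have := Fintype.ofFinite SL(2, A)
  have hN' : (0 : ℝ) < N := by exact_mod_cast hN
  have hG : (0 : ℝ) < Nat.card SL(2, A) := by exact_mod_cast Nat.card_pos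
  have hA : (0 : ℝ) < Nat.card A := by exact_mod_cast Nat.card_pos
  have hsum := chi_mul_card H
  rw [finsum_eq_sum_of_fintype] at hsum
  have hterm : ∀ g ∈ Finset.univ, (Nat.card (unipotentParameters H g) : ℝ) ≤
      (if (unipotentParameters H g).index ≤ 2 * N then (Nat.card A : ℝ) else 0) +
        Nat.card A / (2 * N) := by
    intro g _
    have hmul : (Nat.card (unipotentParameters H g) : ℝ) * (unipotentParameters H g).index =
        Nat.card A := by exact_mod_cast (unipotentParameters H g).card_mul_index
    split_ifs with hg
    · have : (Nat.card (unipotentParameters H g) : ℝ) ≤ Nat.card A := by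
        exact_mod_cast Nat.card_le_card_of_injective _ Subtype.val_injective
      have : (0 : ℝ) ≤ Nat.card A / (2 * N) := by positivity
      linarith
    · rw [zero_add, le_div_iff₀ (by positivity), ← hmul]
      gcongr
      exact_mod_cast (not_le.1 hg).le
  have hle := Finset.sum_le_sum hterm
  rw [← hsum, Finset.sum_add_distrib, ← Finset.sum_filter, Finset.sum_const, Finset.sum_const,
    Finset.card_univ, ← Nat.card_eq_fintype_card, nsmul_eq_mul, nsmul_eq_mul,
    ← Fintype.card_subtype, ← Nat.card_eq_fintype_card] at hle
  push_cast at hle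
  have hlt : 1 / (N : ℝ) * (Nat.card SL(2, A) * Nat.card A) <
      chi H * (Nat.card SL(2, A) * Nat.card A) := by gcongr
  have key := hlt.trans_le hle
  rw [← @Nat.cast_lt ℝ]
  push_cast
  field_simp at key
  linarith

/-- The matrices whose lower left entry is divisible by `t`. -/
def lowerLeftDvd (t : A) : Subgroup SL(2, A) where
  carrier := {g | t ∣ g 1 0}
  one_mem' := by simp
  mul_mem' {g h} hg hh := by
    simp only [Set.mem_ofPred_eq, Matrix.SpecialLinearGroup.coe_mul, Matrix.mul_apply,
      Fin.sum_univ_two] at *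
    exact dvd_add (hg.mul_right _) (hh.mul_left _)
  inv_mem' {g} hg := by
    simp only [Set.mem_ofPred_eq, Matrix.SpecialLinearGroup.coe_inv, Matrix.adjugate_fin_two] at *
    simpa using hg

theorem card_quotient_le_index (t : A) :
    Nat.card (A ⧸ Ideal.span {t}) ≤ (lowerLeftDvd t).index := by
  rw [Subgroup.index]
  refine Nat.card_le_card_of_injective
    (fun x => ((lower x.out : SL(2, A)) : SL(2, A) ⧸ lowerLeftDvd t)) fun x y h => ?_
  have h' : t ∣ ((lower x.out)⁻¹ * lower y.out : SL(2, A)) 1 0 := QuotientGroup.eq.1 h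
  rw [inv_mul_apply_one_zero] at h'
  rw [← Ideal.Quotient.mk_out x, ← Ideal.Quotient.mk_out y]
  refine (Ideal.Quotient.eq.2 (Ideal.mem_span_singleton.2 ?_)).symm
  simpa [lower] using h'

/-- A set of more than `2 / N` of the elements of `SL₂(A)` contains three whose first columns have
pairwise determinants outside `t A`, when `t A` has index at least `N`. -/
theorem exists_three_separated {t : A} {N : ℕ} (hN : N ≤ Nat.card (A ⧸ Ideal.span {t}))
    {S : Set SL(2, A)} (hS : 2 * Nat.card SL(2, A) < N * Nat.card S) :
    ∃ g₁ ∈ S, ∃ g₂ ∈ S, ∃ g₃ ∈ S, ¬ t ∣ (g₁⁻¹ * g₂) 1 0 ∧ ¬ t ∣ (g₁⁻¹ * g₃) 1 0 ∧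
      ¬ t ∣ (g₂⁻¹ * g₃) 1 0 := by
  have hball : ∀ g : SL(2, A), N * {k : SL(2, A) | t ∣ (g⁻¹ * k) 1 0}.ncard ≤
      Nat.card SL(2, A) := fun g => by
    have : {k : SL(2, A) | t ∣ (g⁻¹ * k) 1 0} = (g * ·) '' (lowerLeftDvd t : Set SL(2, A)) := by
      ext k
      simp only [Set.mem_ofPred_eq, Set.mem_image, SetLike.mem_coe]
      exact ⟨fun h => ⟨g⁻¹ * k, h, by simp⟩, by
        rintro ⟨l, hl, rfl⟩; rw [inv_mul_cancel_left]; exact hl⟩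
    rw [this, Set.ncard_image_of_injective _ (mul_right_injective g), ← Nat.card_coe_set_eq,
      ← (lowerLeftDvd t).card_mul_index, mul_comm]
    exact Nat.mul_le_mul_left _ (hN.trans (card_quotient_le_index t))
  rw [Nat.card_coe_set_eq] at hS
  -- two cosets of `lowerLeftDvd t` do not cover `S`
  have hnot : ∀ g g' : SL(2, A), ∃ k ∈ S, ¬ t ∣ (g⁻¹ * k) 1 0 ∧ ¬ t ∣ (g'⁻¹ * k) 1 0 := by
    intro g g'
    by_contra! hcon
    have hsub : S ⊆ {k : SL(2, A) | t ∣ (g⁻¹ * k) 1 0} ∪ {k : SL(2, A) | t ∣ (g'⁻¹ * k) 1 0} :=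
      fun k hk => or_iff_not_imp_left.2 (hcon k hk)
    have h1 := (Set.ncard_le_ncard hsub (Set.toFinite _)).trans (Set.ncard_union_le _ _)
    have h2 := Nat.mul_le_mul_left N h1
    rw [mul_add] at h2
    have := hball g
    have := hball g'
    omega
  obtain ⟨g₁, h₁, -, -⟩ := hnot 1 1
  obtain ⟨g₂, h₂, h₁₂, -⟩ := hnot g₁ g₁
  obtain ⟨g₃, h₃, h₁₃, h₂₃⟩ := hnot g₁ g₂
  exact ⟨g₁, h₁, g₂, h₂, g₃, h₃, h₁₂, h₁₃, h₂₃⟩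

end Counting

/-! ### Subgroups of `SL₂` over a finite chain ring -/

section ChainRing

variable {A : Type*} [CommRing A]

/-- In a ring whose nonunits are all multiples of `π`, this replaces the valuation, which has no
good definition when `π` is nilpotent. -/
theorem dvd_pow_of_not_pow_succ_dvd {π : A} (hπ : ∀ x : A, IsUnit x ∨ π ∣ x) (t : ℕ) {x : A}
    (hx : ¬ π ^ (t + 1) ∣ x) : x ∣ π ^ t := by
  induction t generalizing x with
  | zero =>
    rw [zero_add, pow_one] at hx
    exact ((hπ x).resolve_right hx).dvd
  | succ t ih =>
    rcases hπ x with h | ⟨y, rfl⟩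
    · exact h.dvd
    · rw [pow_succ' π t]
      exact mul_dvd_mul_left π (ih fun h => hx (by rw [pow_succ']; exact mul_dvd_mul_left π h))

/-- A subgroup of `p`-power index at most `p ^ j` contains `p ^ j A`, hence `π ^ (r j) A` if `p`
divides `π ^ r`. -/
theorem pow_mul_mem_of_index_le {π : A} {p r j c a : ℕ} (hp : p.Prime) (hpr : (p : A) ∣ π ^ r)
    (ha : r * j ≤ a) {V : AddSubgroup A} (hV : V.index ∣ p ^ c) (hle : V.index ≤ p ^ j) (u : A) :
    π ^ a * u ∈ V := by
  obtain ⟨k, -, hk⟩ := (Nat.dvd_prime_pow hp).1 hV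
  have hkj : k ≤ j := (Nat.pow_le_pow_iff_right hp.one_lt).1 (hk ▸ hle)
  have hdvd : (p : A) ^ k ∣ π ^ a * u := by
    refine ((pow_dvd_pow _ hkj).trans ((pow_dvd_pow_of_dvd hpr j).trans ?_)).mul_right u
    rw [← pow_mul]
    exact pow_dvd_pow _ ha
  obtain ⟨v, hv⟩ := hdvd
  have := V.nsmul_index_mem v
  rwa [hk, nsmul_eq_mul, Nat.cast_pow, ← hv] at this

/-- The bound on `chi H` over a finite chain ring `A` with uniformizer `π` of nilpotency index at
most `e`, residue cardinality `p ^ f`, and ramification at most `r`, for a subgroup `H` missing an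
element congruent to `1` modulo `π ^ (e - 1)`. -/
theorem chi_le_of_notMem [Finite A] {π : A} {e p f r n m : ℕ} (hp : p.Prime) (hf : 1 ≤ f)
    (hπ : ∀ x : A, IsUnit x ∨ π ∣ x) (hnil : π ^ e = 0) (hcard : Nat.card A = (p ^ f) ^ e)
    (hquot : ∀ t ≤ e, (p ^ f) ^ t ≤ Nat.card (A ⧸ Ideal.span {π ^ t}))
    (hpr : (p : A) ∣ π ^ r) (hrf : r * f ≤ n) (hm : (n + 6) * (m + 3) ≤ e)
    {H : Subgroup SL(2, A)} {k : SL(2, A)} (hkH : k ∉ H) {M : Matrix (Fin 2) (Fin 2) A}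
    (hk : (k : Matrix (Fin 2) (Fin 2) A) = 1 + π ^ (e - 1) • M) :
    chi H ≤ 1 / ((p ^ f) ^ m : ℕ) := by
  by_contra! hlt
  have hq : 2 ≤ p ^ f := hp.two_le.trans (Nat.le_self_pow (by omega) p)
  have hqm : 0 < (p ^ f) ^ m := by positivity
  have he : n * m + 3 * n + 6 * m + 18 ≤ e := by linarith
  have hrfm : r * (f * m + 1) ≤ n * m + n := by
    have h1 : r * f * m ≤ n * m := Nat.mul_le_mul_right m hrf
    have h2 : r ≤ n := (Nat.le_mul_of_pos_right r hf).trans hrf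
    linarith
  have hcount := card_lt_of_lt_chi hqm hlt
  obtain ⟨g₁, h₁, g₂, h₂, g₃, h₃, h₁₂, h₁₃, h₂₃⟩ :=
    exists_three_separated (t := π ^ (m + 2)) (hquot (m + 2) (by omega))
      (S := {g | (unipotentParameters H g).index ≤ 2 * (p ^ f) ^ m}) (by
        refine lt_of_lt_of_le (Nat.mul_lt_mul_of_pos_left hcount two_pos) ?_
        rw [pow_add, ← mul_assoc, ← mul_assoc]
        refine Nat.mul_le_mul_right _ ?_
        nlinarith [Nat.pow_le_pow_left hq 2])
  -- depth of the unipotents used; `3 * (m + 1)` accounts for the three determinants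
  obtain ⟨a, ha⟩ : ∃ a, e - 1 = a + 3 * (m + 1) := ⟨e - 1 - 3 * (m + 1), by omega⟩
  have hmem : ∀ g : SL(2, A), (unipotentParameters H g).index ≤ 2 * (p ^ f) ^ m →
      ∀ u, π ^ a * u ∈ unipotentParameters H g := fun g hg =>
    pow_mul_mem_of_index_le (c := f * e) hp hpr (j := f * m + 1) (by omega)
      (by rw [pow_mul, ← hcard]; exact AddSubgroup.index_dvd_card _)
      (hg.trans (by
        rw [pow_succ', pow_mul]
        exact Nat.mul_le_mul_right _ hp.two_le))
  have hs : π ^ a * π ^ a = 0 := by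
    rw [← pow_add]
    exact pow_eq_zero_of_le (by omega) hnil
  obtain ⟨w₁, hw₁⟩ := dvd_pow_of_not_pow_succ_dvd hπ (m + 1) h₁₂
  obtain ⟨w₂, hw₂⟩ := dvd_pow_of_not_pow_succ_dvd hπ (m + 1) h₁₃
  obtain ⟨w₃, hw₃⟩ := dvd_pow_of_not_pow_succ_dvd hπ (m + 1) h₂₃
  have hsplit : π ^ (e - 1) = π ^ a *
      ((g₁⁻¹ * g₂) 1 0 * (g₁⁻¹ * g₃) 1 0 * (g₂⁻¹ * g₃) 1 0) * (w₁ * w₂ * w₃) := by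
    rw [ha, pow_add, mul_comm 3, pow_mul, pow_succ _ 2, sq]
    nth_rewrite 1 [hw₁]
    nth_rewrite 1 [hw₂]
    nth_rewrite 1 [hw₃]
    ring
  -- the determinant condition makes `M` traceless after multiplication by `π ^ (e - 1)`
  have htrace : π ^ (e - 1) * M 1 1 = -(π ^ (e - 1) * M 0 0) := by
    have hsq : π ^ (e - 1) * π ^ (e - 1) = 0 := by
      rw [← pow_add]
      exact pow_eq_zero_of_le (by omega) hnil
    have hdet := k.det_coe
    rw [hk, Matrix.det_fin_two] at hdet
    simp at hdet
    linear_combination hdet - (M 0 0 * M 1 1 - M 0 1 * M 1 0) * hsq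
  refine hkH (mem_of_unipotentParameters hs (hmem g₁ h₁) (hmem g₂ h₂) (hmem g₃ h₃)
    (x := w₁ * w₂ * w₃ * M 0 0) (y := w₁ * w₂ * w₃ * M 0 1) (z := w₁ * w₂ * w₃ * M 1 0) ?_)
  rw [hk]
  congr 1
  ext i j
  fin_cases i <;> fin_cases j <;>
    simp only [Matrix.smul_apply, smul_eq_mul, Fin.zero_eta, Fin.mk_one, Matrix.of_apply,
      Matrix.cons_val', Matrix.cons_val_zero, Matrix.cons_val_one, Matrix.cons_val_fin_one, htrace]
  all_goals rw [hsplit]; ring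

end ChainRing

/-! ### Quotients of a Dedekind domain by a prime power -/

section Dedekind

variable {R : Type*} [CommRing R] {𝔭 : Ideal R} {e : ℕ}

/-- The image of `𝔭` in `R ⧸ 𝔭 ^ e` is principal, generated by the class of any element of
`𝔭 \ 𝔭 ^ 2`. -/
theorem exists_map_mk_eq_span [IsDedekindDomain R] (hp : 𝔭.IsPrime) (h0 : 𝔭 ≠ ⊥) (he : 1 ≤ e) :
    ∃ π : R ⧸ 𝔭 ^ e, 𝔭.map (Ideal.Quotient.mk (𝔭 ^ e)) = Ideal.span {π} := by
  obtain ⟨x, hx, hx2⟩ := Ideal.exists_mem_pow_notMem_pow_succ 𝔭 h0 hp.ne_top 1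
  rw [pow_one] at hx
  have hx0 : Ideal.span {x} ≠ ⊥ := fun h => hx2 (by simp [Ideal.span_singleton_eq_bot.1 h])
  have hirr : Irreducible 𝔭 := ((Ideal.prime_iff_isPrime h0).2 hp).irreducible
  have hsup := Ideal.irreducible_pow_sup hx0 hirr e
  generalize min _ e = c at hsup
  have hxc : x ∈ 𝔭 ^ c := hsup ▸ Ideal.mem_sup_right (Ideal.mem_span_singleton_self x)
  have hle : 𝔭 ^ c ≤ 𝔭 := hsup ▸ sup_le (Ideal.pow_le_self (by omega))
    ((Ideal.span_singleton_le_iff_mem 𝔭).2 hx)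
  have hc : c = 1 := by
    rcases Nat.lt_trichotomy c 1 with h | h | h
    · obtain rfl : c = 0 := by omega
      exact absurd (top_le_iff.1 (by simpa using hle)) hp.ne_top
    · exact h
    · exact absurd (Ideal.pow_le_pow_right h hxc) hx2
  rw [hc, pow_one] at hsup
  refine ⟨Ideal.Quotient.mk _ x, ?_⟩
  rw [← Set.image_singleton, ← Ideal.map_span, ← bot_sup_eq (Ideal.map _ (Ideal.span {x})),
    ← Ideal.map_quotient_self (𝔭 ^ e), ← Ideal.map_sup, hsup]

theorem isUnit_or_dvd_of_map_mk_eq_span [IsDedekindDomain R] (hp : 𝔭.IsPrime) (h0 : 𝔭 ≠ ⊥)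
    {π : R ⧸ 𝔭 ^ e} (hπ : 𝔭.map (Ideal.Quotient.mk (𝔭 ^ e)) = Ideal.span {π}) (x : R ⧸ 𝔭 ^ e) :
    IsUnit x ∨ π ∣ x := by
  obtain ⟨x, rfl⟩ := Ideal.Quotient.mk_surjective x
  by_cases hx : x ∈ 𝔭
  · exact .inr (Ideal.mem_span_singleton.1 (hπ ▸ Ideal.mem_map_of_mem _ hx))
  · left
    have hmax : 𝔭.IsMaximal := hp.isMaximal h0
    have hsup : Ideal.span {x} ⊔ 𝔭 = ⊤ := by
      rw [sup_comm]
      exact hmax.out.2 _ (left_lt_sup.2 fun h => hx ((Ideal.span_singleton_le_iff_mem 𝔭).1 h))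
    have htop := Ideal.sup_pow_eq_top (n := e) hsup
    have hmap := congrArg (Ideal.map (Ideal.Quotient.mk (𝔭 ^ e))) htop
    rw [Ideal.map_sup, Ideal.map_quotient_self, sup_bot_eq, Ideal.map_span, Set.image_singleton,
      Ideal.map_top] at hmap
    exact Ideal.span_singleton_eq_top.1 hmap

theorem card_quotient_pow [IsDedekindDomain R] (hp : 𝔭.IsPrime) (h0 : 𝔭 ≠ ⊥) (t : ℕ) :
    Nat.card (R ⧸ 𝔭 ^ t) = Nat.card (R ⧸ 𝔭) ^ t :=
  cardQuot_pow_of_prime h0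

/-- An element of the kernel of reduction modulo `𝔭 ^ j` is `1 + π ^ j M`. -/
theorem exists_eq_one_add_smul_of_mem_ker {j : ℕ} (hj : j ≤ e) {π : R ⧸ 𝔭 ^ e}
    (hπ : 𝔭.map (Ideal.Quotient.mk (𝔭 ^ e)) = Ideal.span {π}) {k : SL(2, R ⧸ 𝔭 ^ e)}
    (hk : k ∈ (reduction 𝔭 hj).ker) :
    ∃ M : Matrix (Fin 2) (Fin 2) (R ⧸ 𝔭 ^ e),
      (k : Matrix (Fin 2) (Fin 2) (R ⧸ 𝔭 ^ e)) = 1 + π ^ j • M := by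
  have hdvd : ∀ i i', ∃ y, (k i i' : R ⧸ 𝔭 ^ e) - (1 : Matrix (Fin 2) (Fin 2) (R ⧸ 𝔭 ^ e)) i i' =
      π ^ j * y := by
    intro i i'
    have h1 : Ideal.Quotient.factorPow 𝔭 hj (k i i') =
        (1 : Matrix (Fin 2) (Fin 2) (R ⧸ 𝔭 ^ j)) i i' :=
      congrArg (fun g : SL(2, R ⧸ 𝔭 ^ j) => g i i') (MonoidHom.mem_ker.1 hk)
    have h2 : (k i i' : R ⧸ 𝔭 ^ e) - (1 : Matrix (Fin 2) (Fin 2) (R ⧸ 𝔭 ^ e)) i i' ∈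
        RingHom.ker (Ideal.Quotient.factorPow 𝔭 hj) := by
      rw [RingHom.mem_ker, map_sub, h1, sub_eq_zero]
      simp only [Matrix.one_apply]
      split_ifs <;> simp
    rw [Ideal.Quotient.factorPow, Ideal.Quotient.factor_ker, Ideal.map_pow, hπ,
      Ideal.span_singleton_pow] at h2
    exact Ideal.mem_span_singleton.1 h2
  choose y hy using hdvd
  refine ⟨Matrix.of y, ?_⟩
  ext i i'
  rw [Matrix.add_apply, Matrix.smul_apply, smul_eq_mul, Matrix.of_apply, ← hy]
  ring

/-- `(R ⧸ 𝔭 ^ e) ⧸ (π ^ t)` surjects onto `R ⧸ 𝔭 ^ t`. -/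
theorem card_le_card_quotient_span_pow [IsDedekindDomain R] (hp : 𝔭.IsPrime) (h0 : 𝔭 ≠ ⊥)
    [Finite (R ⧸ 𝔭 ^ e)] {t : ℕ} (ht : t ≤ e) {π : R ⧸ 𝔭 ^ e} (hπ : 𝔭.map (Ideal.Quotient.mk (𝔭 ^ e)) = Ideal.span {π}) :
    Nat.card (R ⧸ 𝔭) ^ t ≤ Nat.card ((R ⧸ 𝔭 ^ e) ⧸ Ideal.span {π ^ t}) := by
  have hker : ∀ a ∈ Ideal.span {π ^ t}, Ideal.Quotient.factorPow 𝔭 ht a = 0 := fun a ha => by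
    rw [← Ideal.span_singleton_pow, ← hπ, ← Ideal.map_pow, ← Ideal.Quotient.factor_ker
      (Ideal.pow_le_pow_right ht)] at ha
    exact ha
  have : Finite ((R ⧸ 𝔭 ^ e) ⧸ Ideal.span {π ^ t}) :=
    Finite.of_surjective _ Ideal.Quotient.mk_surjective
  rw [← card_quotient_pow hp h0]
  refine Nat.card_le_card_of_surjective (Ideal.Quotient.lift _ _ hker) fun y => ?_
  obtain ⟨y, rfl⟩ := Ideal.Quotient.mk_surjective y
  exact ⟨Ideal.Quotient.mk _ (Ideal.Quotient.mk _ y), rfl⟩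

theorem mem_pow_of_pow_dvd_mk {t : ℕ} (ht : t ≤ e) {π : R ⧸ 𝔭 ^ e}
    (hπ : 𝔭.map (Ideal.Quotient.mk (𝔭 ^ e)) = Ideal.span {π}) {x : R}
    (hx : π ^ t ∣ Ideal.Quotient.mk (𝔭 ^ e) x) : x ∈ 𝔭 ^ t := by
  rw [← Ideal.mem_span_singleton, ← Ideal.span_singleton_pow, ← hπ, ← Ideal.map_pow,
    ← Ideal.Quotient.factor_ker (Ideal.pow_le_pow_right ht), RingHom.mem_ker] at hx
  exact Ideal.Quotient.eq_zero_iff_mem.1 hx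

end Dedekind

/-! ### The bound for number fields -/

section NumberField

variable {K : Type*} [Field K] [NumberField K] {𝔭 : Ideal (𝓞 K)} {e : ℕ}

/-- The bound `(ramification index) * (residue degree) ≤ [K : ℚ]`, read off from norms. -/
theorem mul_le_finrank_of_mem_pow {p f t : ℕ} (hp : p.Prime)
    (hcard : Nat.card (𝓞 K ⧸ 𝔭) = p ^ f) (ht : (p : 𝓞 K) ∈ 𝔭 ^ t) :
    t * f ≤ Module.finrank ℚ K := by
  have h1 : Ideal.absNorm 𝔭 = p ^ f := hcard
  have h2 := Ideal.absNorm_dvd_absNorm_of_le ((Ideal.span_singleton_le_iff_mem _).2 ht)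
  have h3 : Algebra.norm ℤ (p : 𝓞 K) = (p : ℤ) ^ Module.finrank ℤ (𝓞 K) := by
    simpa using Algebra.norm_algebraMap (S := 𝓞 K) (p : ℤ)
  rw [map_pow, h1, Ideal.absNorm_span_singleton, h3, Int.natAbs_pow, Int.natAbs_natCast,
    NumberField.RingOfIntegers.rank, ← pow_mul, mul_comm] at h2
  exact (Nat.pow_dvd_pow_iff_le_right hp.one_lt).1 h2

/-- The integral form of the bound: when `e` is large compared with `m`, exact level `e` forces
`chi H ≤ q ^ (-m)`. -/
theorem chi_le_inv_card_pow (hp : 𝔭.IsPrime) (h0 : 𝔭 ≠ ⊥) {m : ℕ}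
    (hm : (Module.finrank ℚ K + 6) * (m + 3) ≤ e) {H : Subgroup SL(2, 𝓞 K ⧸ 𝔭 ^ e)}
    (hH : HasExactLevel 𝔭 e H) : chi H ≤ 1 / (Nat.card (𝓞 K ⧸ 𝔭) ^ m : ℕ) := by
  have he : 1 < e := by nlinarith
  have hfin : Finite (𝓞 K ⧸ 𝔭) := Ideal.finiteQuotientOfFreeOfNeBot 𝔭 h0
  have hfine : Finite (𝓞 K ⧸ 𝔭 ^ e) :=
    Ideal.finiteQuotientOfFreeOfNeBot _ (pow_ne_zero e h0)
  have hmax : 𝔭.IsMaximal := hp.isMaximal h0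
  let _ := Ideal.Quotient.field 𝔭
  have := Fintype.ofFinite (𝓞 K ⧸ 𝔭)
  obtain ⟨p, hchar, f, hpp, hcard⟩ := FiniteField.card' (𝓞 K ⧸ 𝔭)
  rw [← Nat.card_eq_fintype_card] at hcard
  obtain ⟨π, hπ⟩ := exists_map_mk_eq_span hp h0 he.le
  have hunit := isUnit_or_dvd_of_map_mk_eq_span hp h0 hπ
  have hnil : π ^ e = 0 := by
    rw [← Ideal.span_singleton_eq_bot, ← Ideal.span_singleton_pow, ← hπ, ← Ideal.map_pow,
      Ideal.map_quotient_self]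
  obtain ⟨k, hk, hkH⟩ : ∃ k ∈ (reduction 𝔭 (Nat.sub_le e 1)).ker, k ∉ H :=
    SetLike.not_le_iff_exists.1 fun hle => hH.1 he (Subgroup.comap_map_eq_self hle).symm
  obtain ⟨M, hM⟩ := exists_eq_one_add_smul_of_mem_ker _ hπ hk
  -- the ramification index is at most `n / f`, also when `p` vanishes in the quotient
  have hpr : ((p : ℕ) : 𝓞 K ⧸ 𝔭 ^ e) ∣ π ^ (Module.finrank ℚ K / f) := by
    by_cases hlt : Module.finrank ℚ K / f + 1 ≤ e
    · refine dvd_pow_of_not_pow_succ_dvd hunit _ fun hdvd => ?_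
      have hmem : (p : 𝓞 K) ∈ 𝔭 ^ (Module.finrank ℚ K / f + 1) :=
        mem_pow_of_pow_dvd_mk hlt hπ (by simpa using hdvd)
      have hmul := mul_le_finrank_of_mem_pow hpp hcard hmem
      have := (Nat.le_div_iff_mul_le f.pos).2 hmul
      omega
    · rw [pow_eq_zero_of_le (by omega) hnil]
      exact dvd_zero _
  rw [hcard]
  refine chi_le_of_notMem hpp f.pos hunit hnil ?_ ?_ hpr (Nat.div_mul_le_self _ _) hm hkH hM
  · rw [card_quotient_pow hp h0, hcard]
  · intro t ht
    rw [← hcard]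
    exact card_le_card_quotient_span_pow hp h0 ht hπ

/-- With `m = ⌈α e - B⌉`, the condition `(n + 6) * (m + 3) ≤ e` follows from `α * (n + 6) ≤ 1` and
`4 ≤ B`. -/
theorem chi_le_rpow (hp : 𝔭.IsPrime) (h0 : 𝔭 ≠ ⊥) {B α : ℝ} (hB : 4 ≤ B)
    (hα : α * (Module.finrank ℚ K + 6) ≤ 1) {H : Subgroup SL(2, 𝓞 K ⧸ 𝔭 ^ e)}
    (hH : HasExactLevel 𝔭 e H) :
    chi H ≤ (Nat.card (𝓞 K ⧸ 𝔭) : ℝ) ^ (B - α * e) := by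
  have hfin : Finite (𝓞 K ⧸ 𝔭) := Ideal.finiteQuotientOfFreeOfNeBot 𝔭 h0
  have hfine : Finite (𝓞 K ⧸ 𝔭 ^ e) :=
    Ideal.finiteQuotientOfFreeOfNeBot _ (pow_ne_zero e h0)
  have hq : (1 : ℝ) ≤ Nat.card (𝓞 K ⧸ 𝔭) := by exact_mod_cast Nat.card_pos (α := 𝓞 K ⧸ 𝔭)
  rcases le_or_gt (α * e) B with hle | hgt
  · exact (chi_le_one H).trans (Real.one_le_rpow hq (sub_nonneg.2 hle))
  have hm : (Module.finrank ℚ K + 6) * (⌈α * e - B⌉₊ + 3) ≤ e := by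
    have hceil := Nat.ceil_lt_add_one (sub_pos.2 hgt).le
    rw [← @Nat.cast_le ℝ]
    push_cast
    calc ((Module.finrank ℚ K : ℝ) + 6) * (⌈α * e - B⌉₊ + 3)
        ≤ (Module.finrank ℚ K + 6) * (α * e) := by gcongr; linarith
      _ = α * (Module.finrank ℚ K + 6) * e := by ring
      _ ≤ 1 * e := by gcongr
      _ = e := one_mul _
  refine (chi_le_inv_card_pow hp h0 hm hH).trans ?_
  rw [one_div, Nat.cast_pow, ← Real.rpow_natCast, ← Real.rpow_neg (by linarith)]
  exact Real.rpow_le_rpow_of_exponent_le hq (by linarith [Nat.le_ceil (α * e - B)])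

end NumberField
end LocalCusp

theorem theoremB (n : ℕ) :
    (∃ B α : ℝ, 0 < B ∧ 0 < α ∧
      ∀ (K : Type u) [Field K] [NumberField K], Module.finrank ℚ K = n →
      ∀ (𝔭 : Ideal (𝓞 K)), 𝔭.IsPrime → 𝔭 ≠ ⊥ →
      ∀ (e : ℕ), 1 ≤ e →
      ∀ (H : Subgroup SL(2, 𝓞 K ⧸ 𝔭 ^ e)), LocalCusp.HasExactLevel 𝔭 e H →
        LocalCusp.chi H ≤ (Nat.card (𝓞 K ⧸ 𝔭) : ℝ) ^ (B - α * (e : ℝ))) ∧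
    (∀ (K : Type u) [Field K] [NumberField K], Module.finrank ℚ K = n →
      ∀ (𝔭 : Ideal (𝓞 K)), 𝔭.IsPrime → 𝔭 ≠ ⊥ →
      ∀ (e : ℕ), 1 ≤ e →
      ∀ (H : Subgroup SL(2, 𝓞 K ⧸ 𝔭 ^ e)), LocalCusp.HasExactLevel 𝔭 e H →
        (3 ≤ ringChar (𝓞 K ⧸ 𝔭) →
          LocalCusp.chi H ≤ (Nat.card (𝓞 K ⧸ 𝔭) : ℝ) ^
            ((7 * (n : ℝ) + 4) - 1 / (2 * (n : ℝ) * (6 + 4 * (n : ℝ))) * (e : ℝ))) ∧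
        (ringChar (𝓞 K ⧸ 𝔭) = 2 →
          LocalCusp.chi H ≤ (Nat.card (𝓞 K ⧸ 𝔭) : ℝ) ^
            ((13 / 2 * (n : ℝ) ^ 2 + 27 / 2 * (n : ℝ) + 17 / 2) -
              1 / (2 * (n : ℝ) * (18 + 34 * (n : ℝ))) * (e : ℝ)))) := by
  refine ⟨⟨4, 1 / (n + 6), by norm_num, by positivity, ?_⟩, ?_⟩
  · rintro K _ _ rfl 𝔭 hp h0 e - H hH
    exact LocalCusp.chi_le_rpow hp h0 le_rfl (by field_simp; rfl) hH
  · rintro K _ _ rfl 𝔭 hp h0 e - H hH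
    have hn : (1 : ℝ) ≤ Module.finrank ℚ K := by
      exact_mod_cast Module.finrank_pos (R := ℚ) (M := K)
    constructor <;> intro _ <;> refine LocalCusp.chi_le_rpow hp h0 ?_ ?_ hH
    · linarith
    · rw [one_div_mul_eq_div, div_le_one (by positivity)]
      nlinarith
    · nlinarith
    · rw [one_div_mul_eq_div, div_le_one (by positivity)]
      nlinarith
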